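/- Let $\mathcal A$ be a unital complex Banach algebra and $\varphi:\mathcal A\to\mathbb C$ a continuous linear functional with $\varphi(1)=1$. For $a,b\in\mathcal A$ and $t,s\in\mathbb C$ near $0$ put $$h_a(t)=\varphi((1-ta)^{-1}),\qquad \psi_a(t)=h_a(t)-1,\qquad H_{a,b}(t,s)=\varphi\big((1-ta)^{-1}(1-sb)^{-1}\big).$$ If $\varphi(a)\neq0$, then $\psi_a(0)=0$ and $\psi_a'(0)=\varphi(a)\ne 0$, and $\mathcal X_a$ denotes the inverse function of $\psi_a$ near $0$, with $\mathcal X_a(0)=0$. If $\varphi(a)\neq0$ and $\varphi(b)\neq 0$, the two-variable partial bi-free $S$-transform of the two-faced pair $(a,b)$ (left variable $a$, right variable $b$) is, for $(z,w)\in(\mathbb C\setminus\{0\})^2$ near $(0,0)$, $$S_{a,b}(z,w)=\frac{z+1}{z}\,\frac{w+1}{w}\left(1-\frac{1+z+w}{H_{a,b}(\mathcal X_a(z),\mathcal X_b(w))}\right).$$ Two two-faced pairs $(a_1,b_1)$, $(a_2,b_2)$ in $(\mathcal A,\varphi)$ are bi-free if there are complex vector spaces $X_k=\mathbb C\xi_k\oplus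 X_k^\circ$ and linear operators $T_k,S_k$ on $X_k$ ($k=1,2$) such that, for every noncommutative polynomial $P$ in four variables, $\varphi(P(a_1,a_2,b_1,b_2))$ is the coefficient of $\xi$ in $P(\lambda_1(T_1),\lambda_2(T_2),\rho_1(S_1),\rho_2(S_2))\,\xi$. Here $\lambda_k$ and $\rho_k$ are the left and right representations of the linear operators on $X_k$ on the free product $X=\mathbb C\xi\oplus\bigoplus_{n\ge1}\bigoplus_{k_1\ne k_2\neq\cdots\ne k_n}X_{k_1}^\circ\otimes\cdots\otimes X_{k_n}^\circ$; that is, $\lambda_k(T)$ acts as $T\otimes 1$ under the canonical isomorphism of $X$ with $X_k\otimes X(\ell,k)$, and $\rho_k(T)$ acts as $1\otimes T$ under that with $X(r,k)\otimes X_k$, where $X(\ell,k)$ and $X(r,k)$ are the sums of $\mathbb C\xi$ and the summands with $k_1\ne k$, respectively $k_n\neq k$. **Theorem 2.1.** Let $(a_1,b_1)$ and $(a_2,b_2)$ be a bi-free pair of two-faced pairs in $(\mathcal A,\varphi)$ with $\varphi(a_1),\varphi(a_2),\varphi(b_1),\varphi(b_2)$ all nonzero. Then $\varphi(a_1a_2)\ne0$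 and $\varphi(b_1b_2)\neq0$, so that $S_{a_1a_2,b_1b_2}$ is defined, and $$S_{a_1a_2,b_1b_2}(z,w)=S_{a_1,b_1}(z,w)\,S_{a_2,b_2}(z,w)$$ for all $(z,w)\in(\mathbb C\setminus\{0\})^2$ sufficiently close to $(0,0)$. -/

import Mathlib

open Filter Topology
open scoped DirectSum

universe u v w

set_option linter.unusedSectionVars false

namespace BiFree

noncomputable section

/-! ### Free products of vector spaces with a specified state vector

A vector space with a specified state vector is a triple `(X, X°, ξ)` with `X = ℂ ξ ⊕ X°`. Such a
triple is written here as `X = ℂ × V`, `ξ = (1, 0)`, `X° = V`. The free product of the family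
`ℂ × V k` is `ℂ ξ ⊕ ⨁ V k₁ ⊗ ⋯ ⊗ V kₙ`, the sum being over `n ≥ 1` and `k₁ ≠ k₂ ≠ ⋯ ≠ kₙ`; it is
realised inside the tensor algebra of `⨁ k, V k`, with `ξ = 1`. -/

section FreeProduct


variable {ι : Type u} [DecidableEq ι] (V : ι → Type v)
  [∀ k, AddCommGroup (V k)] [∀ k, Module ℂ (V k)]

/-- The full tensor algebra of `⨁ k, V k`. -/
abbrev Tens : Type (max u v) := TensorAlgebra ℂ (⨁ k, V k)

variable {V}

/-- A vector of `V k`, as a tensor of degree one. -/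
def letter (k : ι) : V k →ₗ[ℂ] Tens V :=
  TensorAlgebra.ι ℂ ∘ₗ DirectSum.lof ℂ ι V k

/-- The pure tensor `x₁ ⊗ ⋯ ⊗ xₙ` with `xᵢ ∈ V kᵢ`; the empty word gives `ξ = 1`. -/
def word (l : List (Σ k, V k)) : Tens V := (l.map fun x => letter x.1 x.2).prod

/-- `k₁ ≠ k₂ ≠ ⋯ ≠ kₙ` for the indices of the letters. -/
def Alternating (l : List (Σ k, V k)) : Prop := l.IsChain fun x y => x.1 ≠ y.1

variable (V)

/-- The free product of the vector spaces with state vector `ℂ × V k`. -/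
def freeProd : Submodule ℂ (Tens V) := Submodule.span ℂ {w | ∃ l, Alternating l ∧ w = word l}

/-- The state vector of the free product. -/
def stateVector : freeProd V := ⟨1, Submodule.subset_span ⟨[], List.isChain_nil, rfl⟩⟩

/-- The coefficient of the state vector: it is `1` on `ξ` and `0` on tensors of positive degree. -/
def vacuumCoeff : freeProd V →ₗ[ℂ] ℂ :=
  (TensorAlgebra.algebraMapInv (R := ℂ) (M := ⨁ k, V k)).toLinearMap ∘ₗ (freeProd V).subtype

variable {V}

/-- The inclusion of `ℂ × V k` into the tensors, `(1, 0) ↦ ξ = 1` and `(0, x) ↦ x`. -/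
def incl (k : ι) : (ℂ × V k) →ₗ[ℂ] Tens V :=
  LinearMap.coprod (Algebra.linearMap ℂ (Tens V)) (letter k)

/-- One step of the recursion on the left. -/
def stepLeft (L : (⨁ k, V k) →ₗ[ℂ] Tens V) :
    (⨁ k, V k) →ₗ[ℂ] Module.End ℂ (Tens V × Tens V) where
  toFun x := LinearMap.prod
    (LinearMap.mulLeft ℂ (TensorAlgebra.ι ℂ x) ∘ₗ LinearMap.fst ℂ _ _)
    (LinearMap.mulLeft ℂ (L x) ∘ₗ LinearMap.fst ℂ _ _)
  map_add' x y := by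
    refine LinearMap.ext fun p => Prod.ext ?_ ?_ <;> simp [add_mul]
  map_smul' c x := by
    refine LinearMap.ext fun p => Prod.ext ?_ ?_ <;> simp

/-- One step of the recursion on the right. -/
def stepRight (L : (⨁ k, V k) →ₗ[ℂ] Tens V) :
    (⨁ k, V k) →ₗ[ℂ] (Module.End ℂ (Tens V × Tens V))ᵐᵒᵖ where
  toFun x := MulOpposite.op (LinearMap.prod
    (LinearMap.mulRight ℂ (TensorAlgebra.ι ℂ x) ∘ₗ LinearMap.fst ℂ _ _)
    (LinearMap.mulRight ℂ (L x) ∘ₗ LinearMap.fst ℂ _ _))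
  map_add' x y := by
    refine MulOpposite.unop_injective (LinearMap.ext fun p => Prod.ext ?_ ?_) <;> simp [mul_add]
  map_smul' c x := by
    refine MulOpposite.unop_injective (LinearMap.ext fun p => Prod.ext ?_ ?_) <;> simp

/-- The linear map `f` with `f 1 = c` and `f (x ⊗ v) = L x ⊗ v`
(see `peelLeft_one`, `peelLeft_mul`). -/
def peelLeft (c : Tens V) (L : (⨁ k, V k) →ₗ[ℂ] Tens V) : Module.End ℂ (Tens V) :=
  LinearMap.snd ℂ _ _ ∘ₗ LinearMap.applyₗ ((1 : Tens V), c) ∘ₗ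
    (TensorAlgebra.lift ℂ (stepLeft L)).toLinearMap

/-- The linear map `f` with `f 1 = c` and `f (v ⊗ x) = v ⊗ L x`
(see `peelRight_one`, `peelRight_mul`). -/
def peelRight (c : Tens V) (L : (⨁ k, V k) →ₗ[ℂ] Tens V) : Module.End ℂ (Tens V) :=
  LinearMap.snd ℂ _ _ ∘ₗ LinearMap.applyₗ ((1 : Tens V), c) ∘ₗ
    (MulOpposite.opLinearEquiv ℂ).symm.toLinearMap ∘ₗ
    (TensorAlgebra.lift ℂ (stepRight L)).toLinearMap

theorem peelLeft_one (c : Tens V) (L : (⨁ k, V k) →ₗ[ℂ] Tens V) : peelLeft c L 1 = c := by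
  simp [peelLeft]

theorem peelRight_one (c : Tens V) (L : (⨁ k, V k) →ₗ[ℂ] Tens V) : peelRight c L 1 = c := by
  simp [peelRight]

theorem lift_stepLeft_fst (L : (⨁ k, V k) →ₗ[ℂ] Tens V) (v : Tens V) :
    ∀ p, (TensorAlgebra.lift ℂ (stepLeft L) v p).1 = v * p.1 := by
  induction v using TensorAlgebra.induction with
  | algebraMap r => intro p; simp [Module.algebraMap_end_apply, Algebra.smul_def]
  | ι x => intro p; simp [stepLeft]
  | mul a b ha hb => intro p; simp [ha, hb, mul_assoc]
  | add a b ha hb => intro p; simp [ha, hb, add_mul]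

theorem lift_stepRight_fst (L : (⨁ k, V k) →ₗ[ℂ] Tens V) (v : Tens V) :
    ∀ p, ((TensorAlgebra.lift ℂ (stepRight L) v).unop p).1 = p.1 * v := by
  induction v using TensorAlgebra.induction with
  | algebraMap r =>
    intro p
    simp [MulOpposite.algebraMap_apply, Module.algebraMap_end_apply, Algebra.smul_def,
      Algebra.commutes]
  | ι x => intro p; simp [stepRight]
  | mul a b ha hb => intro p; simp [ha, hb, mul_assoc]
  | add a b ha hb => intro p; simp [ha, hb, mul_add]

theorem peelLeft_mul (c : Tens V) (L : (⨁ k, V k) →ₗ[ℂ] Tens V) (x : ⨁ k, V k) (v : Tens V) :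
    peelLeft c L (TensorAlgebra.ι ℂ x * v) = L x * v := by
  have h := lift_stepLeft_fst L v (1, c)
  simp only [mul_one] at h
  simp only [peelLeft, LinearMap.comp_apply, AlgHom.toLinearMap_apply, map_mul,
    TensorAlgebra.lift_ι_apply, LinearMap.applyₗ_apply_apply, Module.End.mul_apply]
  exact congrArg (L x * ·) h

theorem peelRight_mul (c : Tens V) (L : (⨁ k, V k) →ₗ[ℂ] Tens V) (x : ⨁ k, V k) (v : Tens V) :
    peelRight c L (v * TensorAlgebra.ι ℂ x) = v * L x := by
  have h := lift_stepRight_fst L v (1, c)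
  simp only [one_mul] at h
  simp only [peelRight, LinearMap.comp_apply, AlgHom.toLinearMap_apply, map_mul,
    TensorAlgebra.lift_ι_apply, LinearMap.applyₗ_apply_apply]
  exact congrArg (· * L x) h

/-- The part of a vector of `⨁ k, V k` in `V k`. -/
def part (k : ι) : (⨁ k, V k) →ₗ[ℂ] V k := DirectSum.component ℂ ι V k

/-- The part of a vector of `⨁ k, V k` outside `V k`. -/
def rest (k : ι) : Module.End ℂ (⨁ k, V k) := LinearMap.id - DirectSum.lof ℂ ι V k ∘ₗ part k

/-- The left operator of `T` on tensors: `1 ↦ T ξ`, `x ⊗ v ↦ T x ⊗ v` if `x ∈ V k`, and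
`x ⊗ v ↦ T ξ ⊗ x ⊗ v` if `x ∈ V j` with `j ≠ k`. Here `T y ∈ ℂ × V k` is read as a tensor. -/
def leftTens (k : ι) (T : Module.End ℂ (ℂ × V k)) : Module.End ℂ (Tens V) :=
  peelLeft (incl k (T (1, 0)))
    (incl k ∘ₗ T ∘ₗ LinearMap.inr ℂ ℂ (V k) ∘ₗ part k +
      LinearMap.mulLeft ℂ (incl k (T (1, 0))) ∘ₗ TensorAlgebra.ι ℂ ∘ₗ rest k)

/-- The right operator of `T` on tensors: `1 ↦ T ξ`, `v ⊗ x ↦ v ⊗ T x` if `x ∈ V k`, and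
`v ⊗ x ↦ v ⊗ x ⊗ T ξ` if `x ∈ V j` with `j ≠ k`. Here `T y ∈ ℂ × V k` is read as a tensor. -/
def rightTens (k : ι) (T : Module.End ℂ (ℂ × V k)) : Module.End ℂ (Tens V) :=
  peelRight (incl k (T (1, 0)))
    (incl k ∘ₗ T ∘ₗ LinearMap.inr ℂ ℂ (V k) ∘ₗ part k +
      LinearMap.mulRight ℂ (incl k (T (1, 0))) ∘ₗ TensorAlgebra.ι ℂ ∘ₗ rest k)

/-- The word does not begin with a letter from `V k`. -/
def NotHead (k : ι) (l : List (Σ k, V k)) : Prop := ∀ x ∈ l.head?, x.1 ≠ k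

/-- The word does not end with a letter from `V k`. -/
def NotLast (k : ι) (l : List (Σ k, V k)) : Prop := ∀ x ∈ l.getLast?, x.1 ≠ k

theorem word_cons (x : Σ k, V k) (l : List (Σ k, V k)) :
    word (x :: l) = letter x.1 x.2 * word l := by simp [word]

theorem word_concat (x : Σ k, V k) (l : List (Σ k, V k)) :
    word (l ++ [x]) = word l * letter x.1 x.2 := by simp [word]

theorem incl_apply (k : ι) (y : ℂ × V k) :
    incl k y = algebraMap ℂ (Tens V) y.1 + letter k y.2 := by
  simp [incl]

theorem leftTens_one (k : ι) (T : Module.End ℂ (ℂ × V k)) :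
    leftTens k T 1 = incl k (T (1, 0)) := peelLeft_one _ _

theorem rightTens_one (k : ι) (T : Module.End ℂ (ℂ × V k)) :
    rightTens k T 1 = incl k (T (1, 0)) := peelRight_one _ _

theorem leftTens_same (k : ι) (T : Module.End ℂ (ℂ × V k)) (x : V k) (v : Tens V) :
    leftTens k T (letter k x * v) = incl k (T (0, x)) * v := by
  simp [leftTens, letter, peelLeft_mul, part, rest, DirectSum.component.lof_self]

theorem rightTens_same (k : ι) (T : Module.End ℂ (ℂ × V k)) (x : V k) (v : Tens V) :
    rightTens k T (v * letter k x) = v * incl k (T (0, x)) := by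
  simp [rightTens, letter, peelRight_mul, part, rest, DirectSum.component.lof_self]

theorem part_lof_ne {k j : ι} (h : j ≠ k) (x : V j) :
    part k (DirectSum.lof ℂ ι V j x) = 0 := by
  simp [part, DirectSum.component.of, h]

theorem leftTens_ne {k j : ι} (h : j ≠ k) (T : Module.End ℂ (ℂ × V k)) (x : V j) (v : Tens V) :
    leftTens k T (letter j x * v) = incl k (T (1, 0)) * (letter j x * v) := by
  have h0 : T (0, 0) = 0 := map_zero T
  simp [leftTens, letter, peelLeft_mul, rest, part_lof_ne h, h0, mul_assoc]

theorem rightTens_ne {k j : ι} (h : j ≠ k) (T : Module.End ℂ (ℂ × V k)) (x : V j) (v : Tens V) :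
    rightTens k T (v * letter j x) = v * letter j x * incl k (T (1, 0)) := by
  have h0 : T (0, 0) = 0 := map_zero T
  simp [rightTens, letter, peelRight_mul, rest, part_lof_ne h, h0, mul_assoc]

/-- `λ_k(T) V_k = V_k (T ⊗ 1)`, where `V_k (y ⊗ v) = y v` for `y ∈ ℂ × V k` and `v` in the span of
the words that do not begin with a letter from `V k`. -/
theorem leftTens_incl_mul (k : ι) (T : Module.End ℂ (ℂ × V k)) (y : ℂ × V k)
    (l : List (Σ k, V k)) (hl : NotHead k l) :
    leftTens k T (incl k y * word l) = incl k (T y) * word l := by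
  have h1 : leftTens k T (word l) = incl k (T (1, 0)) * word l := by
    cases l with
    | nil => simpa [word] using leftTens_one k T
    | cons x l => rw [word_cons]; exact leftTens_ne (hl x (by simp)) T _ _
  have hy : T y = y.1 • T (1, 0) + T (0, y.2) := by
    rw [← map_smul, ← map_add]; simp
  rw [incl_apply, add_mul, map_add, leftTens_same, hy, map_add, map_smul, add_mul,
    ← Algebra.smul_def, map_smul, h1, smul_mul_assoc]

/-- `ρ_k(T) W_k = W_k (1 ⊗ T)`, where `W_k (v ⊗ y) = v y` for `y ∈ ℂ × V k` and `v` in the span of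
the words that do not end with a letter from `V k`. -/
theorem rightTens_mul_incl (k : ι) (T : Module.End ℂ (ℂ × V k)) (y : ℂ × V k)
    (l : List (Σ k, V k)) (hl : NotLast k l) :
    rightTens k T (word l * incl k y) = word l * incl k (T y) := by
  have h1 : rightTens k T (word l) = word l * incl k (T (1, 0)) := by
    rcases List.eq_nil_or_concat' l with rfl | ⟨l, x, rfl⟩
    · simpa [word] using rightTens_one k T
    · rw [word_concat]; exact rightTens_ne (hl x (by simp)) T _ _
  have hy : T y = y.1 • T (1, 0) + T (0, y.2) := by
    rw [← map_smul, ← map_add]; simp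
  rw [incl_apply, mul_add, map_add, rightTens_same, hy, map_add, map_smul, mul_add,
    ← Algebra.commutes, ← Algebra.smul_def, map_smul, h1, mul_smul_comm]

theorem incl_mul_word_mem (k : ι) (y : ℂ × V k) (l : List (Σ k, V k)) (hl : Alternating l)
    (hk : NotHead k l) : incl k y * word l ∈ freeProd V := by
  rw [incl_apply, add_mul, ← Algebra.smul_def]
  refine add_mem (Submodule.smul_mem _ _ (Submodule.subset_span ⟨l, hl, rfl⟩))
    (Submodule.subset_span ⟨⟨k, y.2⟩ :: l, ?_, by rw [word_cons]⟩)
  exact List.isChain_cons.2 ⟨fun x hx => (hk x hx).symm, hl⟩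

theorem word_mul_incl_mem (k : ι) (y : ℂ × V k) (l : List (Σ k, V k)) (hl : Alternating l)
    (hk : NotLast k l) : word l * incl k y ∈ freeProd V := by
  rw [incl_apply, mul_add, ← Algebra.commutes, ← Algebra.smul_def]
  refine add_mem (Submodule.smul_mem _ _ (Submodule.subset_span ⟨l, hl, rfl⟩))
    (Submodule.subset_span ⟨l ++ [⟨k, y.2⟩], ?_, by rw [word_concat]⟩)
  refine List.isChain_append.2 ⟨hl, List.isChain_singleton _, ?_⟩
  intro x hx z hz
  simp only [List.head?_cons, Option.mem_def, Option.some.injEq] at hz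
  subst hz
  exact hk x hx

/-- The isomorphism `V_k` hits every word. -/
theorem exists_left (k : ι) (l : List (Σ k, V k)) (hl : Alternating l) :
    ∃ y l', Alternating l' ∧ NotHead k l' ∧ word l = incl k y * word l' := by
  by_cases hk : NotHead k l
  · exact ⟨(1, 0), l, hl, hk, by simp [incl_apply]⟩
  · cases l with
    | nil => exact absurd (by simp [NotHead]) hk
    | cons x l =>
      obtain ⟨j, x⟩ := x
      have hj : j = k := by simpa [NotHead] using hk
      subst hj
      obtain ⟨h1, h2⟩ := List.isChain_cons.1 hl
      exact ⟨(0, x), l, h2, fun z hz => (h1 z hz).symm, by simp [incl_apply, word_cons]⟩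

/-- The isomorphism `W_k` hits every word. -/
theorem exists_right (k : ι) (l : List (Σ k, V k)) (hl : Alternating l) :
    ∃ y l', Alternating l' ∧ NotLast k l' ∧ word l = word l' * incl k y := by
  by_cases hk : NotLast k l
  · exact ⟨(1, 0), l, hl, hk, by simp [incl_apply]⟩
  · rcases List.eq_nil_or_concat' l with rfl | ⟨l, ⟨j, x⟩, rfl⟩
    · exact absurd (by simp [NotLast]) hk
    · have hj : j = k := by simpa [NotLast] using hk
      subst hj
      obtain ⟨h1, -, h2⟩ := List.isChain_append.1 hl
      exact ⟨(0, x), l, h1, fun z hz => h2 z hz ⟨j, x⟩ (by simp), by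
        simp [incl_apply, word_concat]⟩

theorem leftTens_mem (k : ι) (T : Module.End ℂ (ℂ × V k)) :
    ∀ w ∈ freeProd V, leftTens k T w ∈ freeProd V := by
  intro w hw
  induction hw using Submodule.span_induction with
  | mem w h =>
    obtain ⟨l, hl, rfl⟩ := h
    obtain ⟨y, l', h1, h2, h3⟩ := exists_left k l hl
    rw [h3, leftTens_incl_mul k T y l' h2]
    exact incl_mul_word_mem k _ l' h1 h2
  | zero => simp
  | add a b _ _ ha hb => rw [map_add]; exact add_mem ha hb
  | smul c a _ ha => rw [map_smul]; exact Submodule.smul_mem _ _ ha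

theorem rightTens_mem (k : ι) (T : Module.End ℂ (ℂ × V k)) :
    ∀ w ∈ freeProd V, rightTens k T w ∈ freeProd V := by
  intro w hw
  induction hw using Submodule.span_induction with
  | mem w h =>
    obtain ⟨l, hl, rfl⟩ := h
    obtain ⟨y, l', h1, h2, h3⟩ := exists_right k l hl
    rw [h3, rightTens_mul_incl k T y l' h2]
    exact word_mul_incl_mem k _ l' h1 h2
  | zero => simp
  | add a b _ _ ha hb => rw [map_add]; exact add_mem ha hb
  | smul c a _ ha => rw [map_smul]; exact Submodule.smul_mem _ _ ha

/-- The left representation `λ_k` of the operators on `ℂ × V k` on the free product. -/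
def leftOp (k : ι) (T : Module.End ℂ (ℂ × V k)) : Module.End ℂ (freeProd V) :=
  (leftTens k T).restrict (leftTens_mem k T)

/-- The right representation `ρ_k` of the operators on `ℂ × V k` on the free product. -/
def rightOp (k : ι) (T : Module.End ℂ (ℂ × V k)) : Module.End ℂ (freeProd V) :=
  (rightTens k T).restrict (rightTens_mem k T)

end FreeProduct

/-! ### Bi-freeness -/


/-- The joint distribution of variables `x i` with respect to `φ`: the linear functional
`P ↦ φ (P (x))` on noncommutative polynomials. -/
def jointDistribution {I : Type*} {A : Type*} [Ring A] [Algebra ℂ A] (φ : A →ₗ[ℂ] ℂ)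
    (x : I → A) : FreeAlgebra ℂ I →ₗ[ℂ] ℂ :=
  φ ∘ₗ (FreeAlgebra.lift ℂ x).toLinearMap

/-- The functional `T ↦ (coefficient of ξ in T ξ)` on the operators on a free product. -/
def vacuumState {ι : Type u} [DecidableEq ι] (V : ι → Type v)
    [∀ k, AddCommGroup (V k)] [∀ k, Module ℂ (V k)] : Module.End ℂ (freeProd V) →ₗ[ℂ] ℂ :=
  vacuumCoeff V ∘ₗ LinearMap.applyₗ (stateVector V)

/-- The two-faced pairs `(a k, b k)` (left variable `a k`, right variable `b k`) in `(A, φ)` are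
bi-free: there are vector spaces with state vector `ℂ × V k` and operators `T k`, `S k` on them,
such that the variables `a k`, `b k` have the same joint distribution as the operators
`λ_k (T k)`, `ρ_k (S k)` on the free product. -/
def IsBiFree {ι : Type u} [DecidableEq ι] {A : Type w} [Ring A] [Algebra ℂ A]
    (φ : A →ₗ[ℂ] ℂ) (a b : ι → A) : Prop :=
  ∃ (V : ι → Type v) (_ : ∀ k, AddCommGroup (V k)) (_ : ∀ k, Module ℂ (V k))
    (T S : ∀ k, Module.End ℂ (ℂ × V k)),
    jointDistribution φ (Sum.elim a b) =
      jointDistribution (vacuumState V)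
        (Sum.elim (fun k => leftOp k (T k)) (fun k => rightOp k (S k)))

/-! ### The transforms -/

section Transforms

variable {A : Type*} [NormedRing A] [NormedAlgebra ℂ A]

/-- `h_a(t) = φ((1 - t a)⁻¹)`. -/
def hFun (φ : A →L[ℂ] ℂ) (a : A) (t : ℂ) : ℂ := φ (Ring.inverse (1 - t • a))

/-- `ψ_a(t) = h_a(t) - 1`. -/
def psi (φ : A →L[ℂ] ℂ) (a : A) (t : ℂ) : ℂ := hFun φ a t - 1

/-- `H_{a,b}(t,s) = φ((1 - t a)⁻¹ (1 - s b)⁻¹)`. -/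
def HFun (φ : A →L[ℂ] ℂ) (a b : A) (t s : ℂ) : ℂ :=
  φ (Ring.inverse (1 - t • a) * Ring.inverse (1 - s • b))

theorem hasStrictDerivAt_psi [CompleteSpace A] (φ : A →L[ℂ] ℂ) (a : A) :
    HasStrictDerivAt (psi φ a) (φ a) 0 := by
  have h1 : HasStrictDerivAt (fun t : ℂ => (1 : A) - t • a) (-a) 0 := by
    simpa using ((hasStrictDerivAt_id (0 : ℂ)).smul_const a).const_sub (1 : A)
  have h2 : HasStrictFDerivAt (𝕜 := ℂ) Ring.inverse
      (-ContinuousLinearMap.mulLeftRight ℂ A 1 1) ((1 : A) - (0 : ℂ) • a) := by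
    simpa using hasStrictFDerivAt_ringInverse (𝕜 := ℂ) (1 : Aˣ)
  have h3 := φ.hasStrictFDerivAt.comp_hasStrictDerivAt (0 : ℂ) (h2.comp_hasStrictDerivAt (0 : ℂ) h1)
  have h4 : HasStrictDerivAt (hFun φ a) (φ a) 0 := by
    refine HasStrictDerivAt.congr_deriv (f := hFun φ a) h3 ?_
    simp
  exact h4.sub_const 1

open Classical in
/-- `𝒳_a`, the inverse function of `ψ_a` near `0`, with `𝒳_a(0) = 0`; it exists when `φ(a) ≠ 0`, and
is given the value `0` otherwise. -/
def chi [CompleteSpace A] (φ : A →L[ℂ] ℂ) (a : A) : ℂ → ℂ :=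
  if h : φ a ≠ 0 then (hasStrictDerivAt_psi φ a).localInverse (psi φ a) (φ a) 0 h else 0

/-- The 2-variables partial bi-free S-transform (for `φ(a) ≠ 0`, `φ(b) ≠ 0`). -/
def partialS [CompleteSpace A] (φ : A →L[ℂ] ℂ) (a b : A) (z w : ℂ) : ℂ :=
  (z + 1) / z * ((w + 1) / w) * (1 - (1 + z + w) / HFun φ a b (chi φ a z) (chi φ b w))

end Transforms

end

end BiFree

/-! Index the pairs by 0 and 1. For small nonzero z, w put p = z/(1+z), q = w/(1+w), and let x_k =
(1+z)⁻¹(1 - 𝒳_{a_k}(z) a_k)⁻¹ - 1, with y_k the analogue for b_k at w (`centred`). The definition of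
𝒳 makes φ(x_k) = φ(y_k) = 0.

Two facts carry the proof. The algebraic one (`inverse_one_sub_smul_mul`): with t = p⁻¹ 𝒳_{a₀}(z)
𝒳_{a₁}(z), (1 - t a₀a₁)⁻¹ = (1+z) ∑ p⁻ⁿ (1+x₁)(x₀x₁)ⁿ(1+x₀). Expanded, the sum contains every
alternating product of x₀, x₁ exactly once. The probabilistic one (`IsBiFree.apply_prod_mul_prod`):
for alternating index words l, m, φ(x_l y_m) vanishes unless l = m, and then equals the product of
the φ(x_k y_k). On the free product, y_m builds a word from ξ and x_l must remove it letter by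
letter.

Taking m empty, only the empty word survives, so φ((1 - t a₀a₁)⁻¹) = 1 + z; hence 𝒳_{a₀a₁}(z) = t,
and likewise for b. Write G_k = φ(x_k y_k). The double series for H of the products collapses to its
diagonal, a geometric series: H = (1+z)(1+w)(1+G₀)(1+G₁)/(1 - G₀G₁/(pq)), while H_{a_k,b_k} =
(1+z)(1+w)(1+G_k). Since (1+z+w)/((1+z)(1+w)) = 1 - pq, this gives S_{a_k,b_k} =
(1+G_k/(pq))/(1+G_k), and multiplicativity is an identity of rational functions
(`partialS_identity`). -/

namespace BiFree

/-! ### The left and right representations are algebra homomorphisms. -/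

section Operators

variable {ι : Type u} [DecidableEq ι] {V : ι → Type v}
  [∀ k, AddCommGroup (V k)] [∀ k, Module ℂ (V k)]

/-- Operators on the free product that agree on words agree. -/
theorem freeProd_end_ext {F G : Module.End ℂ (freeProd V)}
    (h : ∀ l (hl : Alternating l), F ⟨word l, Submodule.subset_span ⟨l, hl, rfl⟩⟩ =
      G ⟨word l, Submodule.subset_span ⟨l, hl, rfl⟩⟩) : F = G := by
  refine LinearMap.ext fun ⟨w, hw⟩ => ?_
  induction hw using Submodule.span_induction with
  | mem w h' =>
    obtain ⟨l, hl, rfl⟩ := h'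
    exact h l hl
  | zero => exact (map_zero F).trans (map_zero G).symm
  | add a b ha hb h1 h2 =>
    have := congrArg₂ (· + ·) h1 h2
    simp only [← map_add] at this
    exact this
  | smul c a ha h1 =>
    have := congrArg (c • ·) h1
    simp only [← map_smul] at this
    exact this

/-- Every word has the form y ⊗ v with y in the k-th space, and there the left operator acts as T ⊗
1. The other algebraic rules, left and right, follow in the same way. -/
theorem leftOp_mul (k : ι) (T T' : Module.End ℂ (ℂ × V k)) :
    leftOp k (T * T') = leftOp k T * leftOp k T' := by
  refine freeProd_end_ext fun l hl => Subtype.ext ?_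
  obtain ⟨y, l', -, h2, h3⟩ := exists_left k l hl
  simp only [leftOp, LinearMap.restrict_apply, Module.End.mul_apply, h3,
    leftTens_incl_mul k _ _ l' h2]

theorem rightOp_mul (k : ι) (T T' : Module.End ℂ (ℂ × V k)) :
    rightOp k (T * T') = rightOp k T * rightOp k T' := by
  refine freeProd_end_ext fun l hl => Subtype.ext ?_
  obtain ⟨y, l', -, h2, h3⟩ := exists_right k l hl
  simp only [rightOp, LinearMap.restrict_apply, Module.End.mul_apply, h3,
    rightTens_mul_incl k _ _ l' h2]

theorem leftOp_add (k : ι) (T T' : Module.End ℂ (ℂ × V k)) :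
    leftOp k (T + T') = leftOp k T + leftOp k T' := by
  refine freeProd_end_ext fun l hl => Subtype.ext ?_
  obtain ⟨y, l', -, h2, h3⟩ := exists_left k l hl
  simp only [leftOp, LinearMap.restrict_apply, LinearMap.add_apply, Submodule.coe_add, h3,
    leftTens_incl_mul k _ _ l' h2, map_add, add_mul]

theorem rightOp_add (k : ι) (T T' : Module.End ℂ (ℂ × V k)) :
    rightOp k (T + T') = rightOp k T + rightOp k T' := by
  refine freeProd_end_ext fun l hl => Subtype.ext ?_
  obtain ⟨y, l', -, h2, h3⟩ := exists_right k l hl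
  simp only [rightOp, LinearMap.restrict_apply, LinearMap.add_apply, Submodule.coe_add, h3,
    rightTens_mul_incl k _ _ l' h2, map_add, mul_add]

theorem leftOp_algebraMap (k : ι) (c : ℂ) :
    leftOp (V := V) k (algebraMap ℂ _ c) = algebraMap ℂ _ c := by
  refine freeProd_end_ext fun l hl => Subtype.ext ?_
  obtain ⟨y, l', -, h2, h3⟩ := exists_left k l hl
  simp only [leftOp, LinearMap.restrict_apply, Module.algebraMap_end_apply, Submodule.coe_smul, h3,
    leftTens_incl_mul k _ _ l' h2, map_smul, smul_mul_assoc]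

theorem rightOp_algebraMap (k : ι) (c : ℂ) :
    rightOp (V := V) k (algebraMap ℂ _ c) = algebraMap ℂ _ c := by
  refine freeProd_end_ext fun l hl => Subtype.ext ?_
  obtain ⟨y, l', -, h2, h3⟩ := exists_right k l hl
  simp only [rightOp, LinearMap.restrict_apply, Module.algebraMap_end_apply, Submodule.coe_smul, h3,
    rightTens_mul_incl k _ _ l' h2, map_smul, mul_smul_comm]

/-- The left representation as an algebra homomorphism. -/
noncomputable def leftHom (k : ι) : Module.End ℂ (ℂ × V k) →ₐ[ℂ] Module.End ℂ (freeProd V) :=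
  AlgHom.ofLinearMap
    { toFun := leftOp k
      map_add' := leftOp_add k
      map_smul' := fun c T => by
        rw [Algebra.smul_def, leftOp_mul, leftOp_algebraMap, ← Algebra.smul_def]; rfl }
    (by simpa using leftOp_algebraMap (V := V) k 1) (leftOp_mul k)

/-- The right representation as an algebra homomorphism. -/
noncomputable def rightHom (k : ι) : Module.End ℂ (ℂ × V k) →ₐ[ℂ] Module.End ℂ (freeProd V) :=
  AlgHom.ofLinearMap
    { toFun := rightOp k
      map_add' := rightOp_add k
      map_smul' := fun c T => by
        rw [Algebra.smul_def, rightOp_mul, rightOp_algebraMap, ← Algebra.smul_def]; rfl }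
    (by simpa using rightOp_algebraMap (V := V) k 1) (rightOp_mul k)

theorem coe_leftHom_apply (k : ι) (T : Module.End ℂ (ℂ × V k)) (v : freeProd V) :
    (leftHom k T v : Tens V) = leftTens k T v := rfl

theorem coe_rightHom_apply (k : ι) (T : Module.End ℂ (ℂ × V k)) (v : freeProd V) :
    (rightHom k T v : Tens V) = rightTens k T v := rfl

theorem vacuumCoeff_apply (v : freeProd V) :
    vacuumCoeff V v = TensorAlgebra.algebraMapInv (R := ℂ) (M := ⨁ k, V k) (v : Tens V) := rfl

theorem algebraMapInv_letter (k : ι) (x : V k) :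
    TensorAlgebra.algebraMapInv (R := ℂ) (M := ⨁ k, V k) (letter k x) = 0 := by
  simp [TensorAlgebra.algebraMapInv, letter]

theorem leftTens_word {k : ι} (T : Module.End ℂ (ℂ × V k)) (hT : (T (1, 0)).1 = 0)
    {l : List (Σ k, V k)} (hl : NotHead k l) :
    leftTens k T (word l) = word (⟨k, (T (1, 0)).2⟩ :: l) := by
  have h := leftTens_incl_mul k T (1, 0) l hl
  rw [incl_apply, incl_apply, hT] at h
  simpa [word_cons] using h

theorem rightTens_word {k : ι} (T : Module.End ℂ (ℂ × V k)) (hT : (T (1, 0)).1 = 0)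
    {l : List (Σ k, V k)} (hl : NotLast k l) :
    rightTens k T (word l) = word (l ++ [⟨k, (T (1, 0)).2⟩]) := by
  have h := rightTens_mul_incl k T (1, 0) l hl
  rw [incl_apply, incl_apply, hT] at h
  simpa [word_concat] using h

/-! ### Vacuum moments of alternating products of centred operators. -/

variable (x y : ∀ k, Module.End ℂ (ℂ × V k))

/-- Centred right operators with alternating indices create a word from the state vector. -/
theorem rightHom_prod_stateVector (hy : ∀ k, (y k (1, 0)).1 = 0) (m : List ι)
    (hm : m.IsChain (· ≠ ·)) :
    ((m.map fun k => rightHom k (y k)).prod (stateVector V) : Tens V) =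
      word (m.reverse.map fun k => ⟨k, (y k (1, 0)).2⟩) := by
  induction m with
  | nil => rfl
  | cons i m ih =>
    obtain ⟨h1, h2⟩ := List.isChain_cons.1 hm
    rw [List.map_cons, List.prod_cons, Module.End.mul_apply, coe_rightHom_apply, ih h2,
      rightTens_word _ (hy i)]
    · simp
    · intro z hz
      rw [List.getLast?_map, List.getLast?_reverse] at hz
      cases m with
      | nil => simp at hz
      | cons j m =>
        simp only [List.head?_cons, Option.map_some, Option.mem_def, Option.some.injEq] at hz
        subst hz
        exact (h1 j (by simp)).symm

/-- Centred left operators with alternating indices do not bring back to the state vector a word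
whose first index differs from the index of the first operator to act. -/
theorem vacuum_leftHom_prod_eq_zero (hx : ∀ k, (x k (1, 0)).1 = 0) (l : List ι)
    (k : ι) (hl : (k :: l).IsChain (· ≠ ·)) (v : freeProd V) (r : V k) (m : List (Σ k, V k))
    (hv : (v : Tens V) = word (⟨k, r⟩ :: m)) :
    vacuumCoeff V ((l.reverse.map fun k => leftHom k (x k)).prod v) = 0 := by
  induction l generalizing k v r m with
  | nil => simp [vacuumCoeff_apply, hv, word_cons, algebraMapInv_letter]
  | cons j l ih =>
    obtain ⟨h1, h2⟩ := List.isChain_cons.1 hl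
    rw [List.reverse_cons, List.map_append, List.prod_append, Module.End.mul_apply]
    -- The letter just created has index j, which again differs from the index of the next operator.
    refine ih j h2 _ (x j (1, 0)).2 (⟨k, r⟩ :: m) ?_
    simp only [List.map_cons, List.map_nil, List.prod_cons, List.prod_nil, mul_one]
    rw [coe_leftHom_apply, hv, leftTens_word _ (hx j)]
    intro z hz
    simp only [List.head?_cons, Option.mem_def, Option.some.injEq] at hz
    subst hz
    exact h1 j (by simp)

/-- The list `l` is in order of action, hence the reversal. A left operator either meets a first
letter of its own index, which it can remove at the cost of a scalar, or lengthens the word, after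
which ξ is out of reach. -/
theorem vacuum_leftHom_prod_word (hx : ∀ k, (x k (1, 0)).1 = 0) (hy : ∀ k, (y k (1, 0)).1 = 0)
    (l m : List ι) (hl : l.IsChain (· ≠ ·)) (hm : m.IsChain (· ≠ ·)) (v : freeProd V)
    (hv : (v : Tens V) = word (m.map fun k => ⟨k, (y k (1, 0)).2⟩)) :
    vacuumCoeff V ((l.reverse.map fun k => leftHom k (x k)).prod v) =
      if l = m then (l.map fun k => ((x k * y k) (1, 0)).1).prod else 0 := by
  induction l generalizing m v with
  | nil =>
    cases m with
    | nil => simp [vacuumCoeff_apply, hv, word]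
    | cons i m => simp [vacuumCoeff_apply, hv, word_cons, algebraMapInv_letter]
  | cons j l ih =>
    obtain ⟨h1, h2⟩ := List.isChain_cons.1 hl
    rw [List.reverse_cons, List.map_append, List.prod_append, Module.End.mul_apply]
    simp only [List.map_cons, List.map_nil, List.prod_cons, List.prod_nil, mul_one]
    by_cases hj : NotHead j (m.map fun k => (⟨k, (y k (1, 0)).2⟩ : Σ k, V k))
    · rw [if_neg]
      · refine vacuum_leftHom_prod_eq_zero x hx l j hl _ (x j (1, 0)).2
          (m.map fun k => ⟨k, (y k (1, 0)).2⟩) ?_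
        rw [coe_leftHom_apply, hv, leftTens_word _ (hx j) hj]
      · rintro rfl
        exact hj ⟨j, (y j (1, 0)).2⟩ (by simp) rfl
    · obtain ⟨m, rfl⟩ : ∃ m', m = j :: m' := by
        cases m with
        | nil => exact absurd (by simp [NotHead]) hj
        | cons i m =>
          have : i = j := by simpa [NotHead] using hj
          exact ⟨m, by rw [this]⟩
      obtain ⟨h3, h4⟩ := List.isChain_cons.1 hm
      have hn : NotHead j (m.map fun k => (⟨k, (y k (1, 0)).2⟩ : Σ k, V k)) := by
        intro z hz
        rw [List.head?_map] at hz
        obtain ⟨i, hi, rfl⟩ := Option.mem_map.1 hz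
        exact (h3 i hi).symm
      have hmem : word (m.map fun k => (⟨k, (y k (1, 0)).2⟩ : Σ k, V k)) ∈ freeProd V :=
        Submodule.subset_span ⟨_, (List.isChain_map _).2 h4, rfl⟩
      set c := ((x j * y j) (1, 0)).1 with hc
      set r := ((x j * y j) (1, 0)).2
      have hlet : word (⟨j, r⟩ :: m.map fun k => (⟨k, (y k (1, 0)).2⟩ : Σ k, V k)) ∈
          freeProd V := by
        refine Submodule.subset_span ⟨_, List.isChain_cons.2 ⟨fun z hz => (hn z hz).symm, ?_⟩, rfl⟩
        exact (List.isChain_map _).2 h4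
      -- Applying `x j` to the first letter gives c ξ + r. The ξ part deletes the letter and feeds
      -- the induction; the r part keeps a letter of index j, which the remaining operators cannot
      -- remove.
      have key : leftHom j (x j) v = c • ⟨_, hmem⟩ + ⟨_, hlet⟩ := by
        refine Subtype.ext ?_
        have h := leftTens_incl_mul j (x j) (y j (1, 0)) _ hn
        have h' : incl j (y j (1, 0)) * word (m.map fun k => (⟨k, (y k (1, 0)).2⟩ : Σ k, V k)) =
            word ((j :: m).map fun k => (⟨k, (y k (1, 0)).2⟩ : Σ k, V k)) := by
          rw [List.map_cons, word_cons, incl_apply, hy j]; simp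
        rw [coe_leftHom_apply, hv, ← h', h, incl_apply, add_mul, ← Algebra.smul_def,
          Submodule.coe_add, Submodule.coe_smul]
        exact congrArg (_ + ·) (word_cons ⟨j, r⟩ _).symm
      rw [key, map_add, map_add, map_smul, map_smul, ih m h2 h4 _ rfl,
        vacuum_leftHom_prod_eq_zero x hx l j hl _ r _ rfl]
      simp [List.cons.injEq, hc]

theorem vacuumState_leftHom_prod_mul_rightHom_prod
    (hx : ∀ k, (x k (1, 0)).1 = 0) (hy : ∀ k, (y k (1, 0)).1 = 0)
    (l m : List ι) (hl : l.IsChain (· ≠ ·)) (hm : m.IsChain (· ≠ ·)) :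
    vacuumState V ((l.map fun k => leftHom k (x k)).prod *
        (m.map fun k => rightHom k (y k)).prod) =
      if l = m then (l.map fun k => ((x k * y k) (1, 0)).1).prod else 0 := by
  -- In both products the last factor acts first, so both index words get reversed and the condition
  -- `l = m` is unaffected.
  have hrev : ∀ l : List ι, l.IsChain (· ≠ ·) → l.reverse.IsChain (· ≠ ·) := fun l h =>
    List.isChain_reverse.2 (h.imp fun _ _ h => h.symm)
  have h := vacuum_leftHom_prod_word x y hx hy l.reverse m.reverse (hrev l hl) (hrev m hm)
    ((m.map fun k => rightHom k (y k)).prod (stateVector V))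
    (rightHom_prod_stateVector y hy m hm)
  rw [List.reverse_reverse] at h
  refine h.trans ?_
  simp [List.map_reverse, List.prod_reverse]

theorem vacuumState_leftHom (k : ι) (T : Module.End ℂ (ℂ × V k)) :
    vacuumState V (leftHom k T) = (T (1, 0)).1 := by
  change TensorAlgebra.algebraMapInv (leftTens k T 1) = _
  rw [leftTens_one, incl_apply, map_add, algebraMapInv_letter]
  simp [TensorAlgebra.algebraMapInv]

theorem vacuumState_rightHom (k : ι) (T : Module.End ℂ (ℂ × V k)) :
    vacuumState V (rightHom k T) = (T (1, 0)).1 := by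
  change TensorAlgebra.algebraMapInv (rightTens k T 1) = _
  rw [rightTens_one, incl_apply, map_add, algebraMapInv_letter]
  simp [TensorAlgebra.algebraMapInv]

/-- On ξ the right operator of S gives S ξ inside the k-th space, where the left operator of T acts
as T itself. -/
theorem vacuumState_leftHom_mul_rightHom (k : ι) (T S : Module.End ℂ (ℂ × V k)) :
    vacuumState V (leftHom k T * rightHom k S) = ((T * S) (1, 0)).1 := by
  change TensorAlgebra.algebraMapInv (leftTens k T (rightTens k S 1)) = _
  have h := leftTens_incl_mul k T (S (1, 0)) [] (by simp [NotHead])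
  simp only [word, List.map_nil, List.prod_nil, mul_one] at h
  rw [rightTens_one, h, incl_apply, map_add, algebraMapInv_letter]
  simp [TensorAlgebra.algebraMapInv]

end Operators

/-! ### Transfer of the operator moments to the algebra. -/

section Moments

variable {ι : Type u} [DecidableEq ι] {A : Type w} [Ring A] [Algebra ℂ A]

/-- Equality of joint distributions compares the same noncommutative polynomial on both sides, so an
element of the subalgebra is replaced by one polynomial, evaluated both in the algebra and at the
operators. -/
theorem exists_eq_lift_of_mem_adjoin {I : Type*} {B : Type*} [Ring B] [Algebra ℂ B]
    (a : I → A) (i : I) {x : A} (hx : x ∈ Algebra.adjoin ℂ {a i}) :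
    ∃ P : Polynomial ℂ, FreeAlgebra.lift ℂ a (Polynomial.aeval (FreeAlgebra.ι ℂ i) P) = x ∧
      ∀ b : I → B, FreeAlgebra.lift ℂ b (Polynomial.aeval (FreeAlgebra.ι ℂ i) P) =
        Polynomial.aeval (b i) P := by
  rw [Algebra.adjoin_singleton_eq_range_aeval] at hx
  obtain ⟨P, rfl⟩ := hx
  refine ⟨P, ?_, fun b => ?_⟩
  · rw [← Polynomial.aeval_algHom_apply, FreeAlgebra.lift_ι_apply]; rfl
  · rw [← Polynomial.aeval_algHom_apply, FreeAlgebra.lift_ι_apply]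

/-- Mixed moments of centred elements with alternating indices in a bi-free family. -/
theorem IsBiFree.apply_prod_mul_prod {φ : A →ₗ[ℂ] ℂ} {a b : ι → A}
    (h : IsBiFree.{u, v, w} φ a b) {x y : ι → A}
    (hx : ∀ k, x k ∈ Algebra.adjoin ℂ {a k}) (hy : ∀ k, y k ∈ Algebra.adjoin ℂ {b k})
    (hx0 : ∀ k, φ (x k) = 0) (hy0 : ∀ k, φ (y k) = 0)
    (l m : List ι) (hl : l.IsChain (· ≠ ·)) (hm : m.IsChain (· ≠ ·)) :
    φ ((l.map x).prod * (m.map y).prod) =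
      if l = m then (l.map fun k => φ (x k * y k)).prod else 0 := by
  obtain ⟨V, _, _, T, S, hd⟩ := h
  choose P hP hP' using fun k => exists_eq_lift_of_mem_adjoin (B := Module.End ℂ (freeProd V))
    (Sum.elim a b) (Sum.inl k) (hx k)
  choose Q hQ hQ' using fun k => exists_eq_lift_of_mem_adjoin (B := Module.End ℂ (freeProd V))
    (Sum.elim a b) (Sum.inr k) (hy k)
  set f := FreeAlgebra.lift ℂ (Sum.elim a b)
  set g := FreeAlgebra.lift ℂ
    (Sum.elim (fun k => leftOp k (T k)) (fun k => rightOp k (S k)) : ι ⊕ ι → _)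
  have hfg : ∀ R, φ (f R) = vacuumState V (g R) := fun R => LinearMap.congr_fun hd R
  set X := fun k => Polynomial.aeval (FreeAlgebra.ι ℂ (Sum.inl k : ι ⊕ ι)) (P k)
  set Y := fun k => Polynomial.aeval (FreeAlgebra.ι ℂ (Sum.inr k : ι ⊕ ι)) (Q k)
  have hX : ∀ k, g (X k) = leftHom k (Polynomial.aeval (T k) (P k)) := fun k =>
    (hP' k _).trans (Polynomial.aeval_algHom_apply (leftHom k) (T k) (P k))
  have hY : ∀ k, g (Y k) = rightHom k (Polynomial.aeval (S k) (Q k)) := fun k =>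
    (hQ' k _).trans (Polynomial.aeval_algHom_apply (rightHom k) (S k) (Q k))
  have hmoment : ∀ k, φ (x k * y k) =
      ((Polynomial.aeval (T k) (P k) * Polynomial.aeval (S k) (Q k)) (1, 0)).1 := fun k => by
    rw [← hP, ← hQ, ← map_mul, hfg, map_mul, hX, hY, vacuumState_leftHom_mul_rightHom]
  have hf : (l.map x).prod * (m.map y).prod = f ((l.map X).prod * (m.map Y).prod) := by
    rw [map_mul, map_list_prod, map_list_prod, List.map_map, List.map_map]
    congr 3
    · exact (funext hP).symm
    · exact (funext hQ).symm
  have hg : g ((l.map X).prod * (m.map Y).prod) =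
      (l.map fun k => leftHom k (Polynomial.aeval (T k) (P k))).prod *
        (m.map fun k => rightHom k (Polynomial.aeval (S k) (Q k))).prod := by
    rw [map_mul, map_list_prod, map_list_prod, List.map_map, List.map_map]
    congr 3
    · exact funext hX
    · exact funext hY
  rw [hf, hfg, hg, vacuumState_leftHom_prod_mul_rightHom_prod _ _ _ _ l m hl hm]
  · simp only [hmoment]
  · intro k
    rw [← vacuumState_leftHom, ← hX, ← hfg, hP, hx0]
  · intro k
    rw [← vacuumState_rightHom, ← hY, ← hfg, hQ, hy0]

end Moments

end BiFree

namespace BiFree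

/-! ### Extension to norm limits of polynomials, such as resolvents. -/

section Closure

variable {A : Type w} [NormedRing A] [NormedAlgebra ℂ A]

theorem exists_seq_centred (φ : A →L[ℂ] ℂ) (hφ : φ 1 = 1) (S : Subalgebra ℂ A) {x : A}
    (hx : x ∈ closure (S : Set A)) (hx0 : φ x = 0) :
    ∃ s : ℕ → A, (∀ n, s n ∈ S) ∧ (∀ n, φ (s n) = 0) ∧ Tendsto s atTop (𝓝 x) := by
  obtain ⟨s, hs, hlim⟩ := mem_closure_iff_seq_limit.1 hx
  -- Recentring the approximants does not change the limit, because φ(s n) tends to φ(x) = 0.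
  refine ⟨fun n => s n - algebraMap ℂ A (φ (s n)), fun n => sub_mem (hs n) (S.algebraMap_mem _),
    fun n => by simp [Algebra.algebraMap_eq_smul_one, hφ], ?_⟩
  have h := hlim.sub (((algebraMapCLM ℂ A).continuous.comp φ.continuous).tendsto x |>.comp hlim)
  simpa [hx0] using h

variable {ι : Type u} [DecidableEq ι]

/-- Mixed moments of centred elements of the closed algebras generated by a bi-free family. -/
theorem IsBiFree.apply_prod_mul_prod_of_mem_closure {φ : A →L[ℂ] ℂ} {a b : ι → A}
    (h : IsBiFree.{u, v, w} (φ : A →ₗ[ℂ] ℂ) a b) (hφ : φ 1 = 1) {x y : ι → A}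
    (hx : ∀ k, x k ∈ closure (Algebra.adjoin ℂ {a k} : Set A))
    (hy : ∀ k, y k ∈ closure (Algebra.adjoin ℂ {b k} : Set A))
    (hx0 : ∀ k, φ (x k) = 0) (hy0 : ∀ k, φ (y k) = 0)
    (l m : List ι) (hl : l.IsChain (· ≠ ·)) (hm : m.IsChain (· ≠ ·)) :
    φ ((l.map x).prod * (m.map y).prod) =
      if l = m then (l.map fun k => φ (x k * y k)).prod else 0 := by
  choose s hs hs0 hslim using fun k => exists_seq_centred φ hφ _ (hx k) (hx0 k)
  choose t ht ht0 htlim using fun k => exists_seq_centred φ hφ _ (hy k) (hy0 k)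
  have hL : Tendsto (fun n => φ ((l.map fun k => s k n).prod * (m.map fun k => t k n).prod)) atTop
      (𝓝 (φ ((l.map x).prod * (m.map y).prod))) :=
    (φ.continuous.tendsto _).comp ((tendsto_list_prod l fun k _ => hslim k).mul
      (tendsto_list_prod m fun k _ => htlim k))
  have hR : Tendsto (fun n => (l.map fun k => φ (s k n * t k n)).prod) atTop
      (𝓝 (l.map fun k => φ (x k * y k)).prod) :=
    tendsto_list_prod l fun k _ => (φ.continuous.tendsto _).comp ((hslim k).mul (htlim k))
  have heq : ∀ n, φ ((l.map fun k => s k n).prod * (m.map fun k => t k n).prod) =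
      if l = m then (l.map fun k => φ (s k n * t k n)).prod else 0 := fun n =>
    h.apply_prod_mul_prod (fun k => hs k n) (fun k => ht k n) (fun k => hs0 k n)
      (fun k => ht0 k n) l m hl hm
  refine tendsto_nhds_unique hL ?_
  simp only [heq]
  split_ifs
  · exact hR
  · exact tendsto_const_nhds

end Closure

/-! ### Alternating words in two indices. -/

section AlternatingLists

/-- The alternating list of `0` and `1` of length `n` with head `i`. -/
def altList : Fin 2 → ℕ → List (Fin 2)
  | _, 0 => []
  | i, n + 1 => i :: altList (1 - i) n

theorem altList_isChain (i : Fin 2) (n : ℕ) : (altList i n).IsChain (· ≠ ·) := by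
  induction n generalizing i with
  | zero => exact List.isChain_nil
  | succ n ih =>
    refine List.isChain_cons.2 ⟨?_, ih _⟩
    cases n with
    | zero => simp [altList]
    | succ n => fin_cases i <;> simp [altList]

theorem altList_eq_iff (i j : Fin 2) (n m : ℕ) :
    altList i n = altList j m ↔ n = m ∧ (n = 0 ∨ i = j) := by
  induction n generalizing i j m with
  | zero => cases m <;> simp [altList]
  | succ n ih =>
    cases m with
    | zero => simp [altList]
    | succ m =>
      simp only [altList, List.cons.injEq, ih]
      constructor
      · rintro ⟨rfl, rfl, -⟩; simp
      · rintro ⟨h, h' | rfl⟩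
        · omega
        · simpa using h

variable {M : Type*} [Monoid M] (x : Fin 2 → M)

theorem prod_map_altList_zero_two_mul (n : ℕ) :
    ((altList 0 (2 * n)).map x).prod = (x 0 * x 1) ^ n := by
  induction n with
  | zero => simp [altList]
  | succ n ih => rw [pow_succ', ← ih, mul_add_one]; simp [altList, mul_assoc]

theorem prod_map_altList_zero_two_mul_add_one (n : ℕ) :
    ((altList 0 (2 * n + 1)).map x).prod = (x 0 * x 1) ^ n * x 0 := by
  induction n with
  | zero => simp [altList]
  | succ n ih =>
    rw [pow_succ', mul_assoc, ← ih, mul_add_one, show 2 * n + 2 + 1 = (2 * n + 1) + 1 + 1 from rfl,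
      altList, altList]
    simp [mul_assoc]

theorem prod_map_altList_one (n : ℕ) :
    ((altList 1 (n + 1)).map x).prod = x 1 * ((altList 0 n).map x).prod := by
  simp [altList]

end AlternatingLists

/-! ### Series of alternating products and the resolvent of a product. -/

section Resolvents

variable {A : Type w} [NormedRing A] [NormedAlgebra ℂ A]

/-- The sum of the alternating products with `n` factors `x 0 * x 1`. -/
def altSum (x : Fin 2 → A) (n : ℕ) : A := (1 + x 1) * (x 0 * x 1) ^ n * (1 + x 0)

/-- The four words are (01)ⁿ, 1(01)ⁿ, (01)ⁿ0 and 1(01)ⁿ0. As n varies they exhaust the alternating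
words without repetition, which makes different `altSum`s orthogonal. -/
theorem altSum_eq (x : Fin 2 → A) (n : ℕ) :
    altSum x n = ((altList 0 (2 * n)).map x).prod + ((altList 1 (2 * n + 1)).map x).prod +
      ((altList 0 (2 * n + 1)).map x).prod + ((altList 1 (2 * n + 1 + 1)).map x).prod := by
  rw [prod_map_altList_one, prod_map_altList_one, prod_map_altList_zero_two_mul,
    prod_map_altList_zero_two_mul_add_one, altSum]
  noncomm_ring

/-- The moments of the alternating products of `x` are those of centred free elements. -/
def CentredFree (φ : A →L[ℂ] ℂ) (x : Fin 2 → A) : Prop :=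
  ∀ l : List (Fin 2), l.IsChain (· ≠ ·) → φ (l.map x).prod = if l = [] then 1 else 0

/-- The moments of the alternating products of `x` and `y` are those of centred bi-free pairs. -/
def CentredBiFree (φ : A →L[ℂ] ℂ) (x y : Fin 2 → A) : Prop :=
  ∀ l m : List (Fin 2), l.IsChain (· ≠ ·) → m.IsChain (· ≠ ·) →
    φ ((l.map x).prod * (m.map y).prod) =
      if l = m then (l.map fun k => φ (x k * y k)).prod else 0

theorem CentredFree.apply_altSum {φ : A →L[ℂ] ℂ} {x : Fin 2 → A} (h : CentredFree φ x) (n : ℕ) :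
    φ (altSum x n) = if n = 0 then 1 else 0 := by
  have h' : ∀ i n, φ ((altList i n).map x).prod = if n = 0 then 1 else 0 := fun i n => by
    rw [h _ (altList_isChain i n)]
    cases n <;> simp [altList]
  rw [altSum_eq, map_add, map_add, map_add, h', h', h', h']
  simp

/-- Only equal words pair nontrivially. For n = m the four words contribute (G₀G₁)ⁿ times 1, G₁, G₀
and G₀G₁, where G_k = φ(x_k y_k). -/
theorem CentredBiFree.apply_altSum_mul_altSum {φ : A →L[ℂ] ℂ} {x y : Fin 2 → A}
    (h : CentredBiFree φ x y) (n m : ℕ) :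
    φ (altSum x n * altSum y m) =
      if n = m then (φ (x 0 * y 0) * φ (x 1 * y 1)) ^ n *
        ((1 + φ (x 0 * y 0)) * (1 + φ (x 1 * y 1))) else 0 := by
  have h' : ∀ i n j m, φ (((altList i n).map x).prod * ((altList j m).map y).prod) =
      if n = m ∧ (n = 0 ∨ i = j) then ((altList i n).map fun k => φ (x k * y k)).prod else 0 :=
    fun i n j m => by
      rw [h _ _ (altList_isChain i n) (altList_isChain j m)]
      simp only [altList_eq_iff]
  rw [altSum_eq, altSum_eq]
  simp only [mul_add, add_mul, map_add, h']
  by_cases hnm : n = m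
  · subst hnm
    simp [prod_map_altList_one, prod_map_altList_zero_two_mul,
      prod_map_altList_zero_two_mul_add_one, show ¬(2 * n = 2 * n + 1 + 1) by omega]
    ring
  · simp [hnm]
    split_ifs <;> first | omega | simp

variable [CompleteSpace A]

/-- The alternating resolvent `∑ p⁻ⁿ altSum x n`. -/
noncomputable def altResolvent (x : Fin 2 → A) (p : ℂ) : A :=
  (1 + x 1) * Ring.inverse (1 - p⁻¹ • (x 0 * x 1)) * (1 + x 0)

theorem hasSum_altResolvent {x : Fin 2 → A} {p : ℂ} (h : ‖p⁻¹ • (x 0 * x 1)‖ < 1) :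
    HasSum (fun n => p⁻¹ ^ n • altSum x n) (altResolvent x p) := by
  have h1 := ((hasSum_geom_series_inverse _ h).mul_left (1 + x 1)).mul_right (1 + x 0)
  simp only [smul_pow, mul_smul_comm, smul_mul_assoc] at h1
  exact h1

theorem CentredFree.apply_altResolvent {φ : A →L[ℂ] ℂ} {x : Fin 2 → A} (h : CentredFree φ x)
    {p : ℂ} (hp : ‖p⁻¹ • (x 0 * x 1)‖ < 1) : φ (altResolvent x p) = 1 := by
  have h1 := (hasSum_altResolvent hp).mapL φ
  simp only [map_smul, h.apply_altSum] at h1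
  refine h1.unique ?_
  convert hasSum_single (f := fun n : ℕ => p⁻¹ ^ n • (if n = 0 then (1 : ℂ) else 0)) 0 ?_ using 1
  · simp
  · intro n hn; simp [hn]

theorem CentredBiFree.apply_altResolvent_mul_altResolvent {φ : A →L[ℂ] ℂ} {x y : Fin 2 → A}
    (h : CentredBiFree φ x y) {p q : ℂ} (hp : ‖p⁻¹ • (x 0 * x 1)‖ < 1)
    (hq : ‖q⁻¹ • (y 0 * y 1)‖ < 1)
    (hD : ‖p⁻¹ * q⁻¹ * (φ (x 0 * y 0) * φ (x 1 * y 1))‖ < 1) :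
    φ (altResolvent x p * altResolvent y q) =
      (1 + φ (x 0 * y 0)) * (1 + φ (x 1 * y 1)) /
        (1 - p⁻¹ * q⁻¹ * (φ (x 0 * y 0) * φ (x 1 * y 1))) := by
  set G := φ (x 0 * y 0) * φ (x 1 * y 1)
  set c := (1 + φ (x 0 * y 0)) * (1 + φ (x 1 * y 1))
  have h1 : ∀ n, φ (altSum x n * altResolvent y q) = q⁻¹ ^ n * (G ^ n * c) := fun n => by
    have h2 := ((hasSum_altResolvent hq).mul_left (altSum x n)).mapL φ
    simp only [mul_smul_comm, map_smul, h.apply_altSum_mul_altSum] at h2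
    refine h2.unique ?_
    convert hasSum_single (f := fun m : ℕ => q⁻¹ ^ m • (if n = m then G ^ n * c else 0)) n ?_ using 1
    · simp
    · intro m hm; simp [hm.symm]
  have h3 := ((hasSum_altResolvent hp).mul_right (altResolvent y q)).mapL φ
  simp only [smul_mul_assoc, map_smul, h1, smul_eq_mul] at h3
  refine h3.unique ?_
  have e : (fun n => p⁻¹ ^ n * (q⁻¹ ^ n * (G ^ n * c))) = fun n => (p⁻¹ * q⁻¹ * G) ^ n * c :=
    funext fun n => by rw [mul_pow, mul_pow]; ring
  rw [e, div_eq_inv_mul]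
  exact (hasSum_geometric_of_norm_lt_one hD).mul_right c

/-- Factorisation of `1 - t a₀ a₁` through the resolvents of `a₀` and `a₁`. -/
theorem inverse_one_sub_smul_mul {a₀ a₁ : A} {τ₀ τ₁ z : ℂ} (hz : z ≠ 0) (hz1 : 1 + z ≠ 0)
    (h₀ : IsUnit (1 - τ₀ • a₀)) (h₁ : IsUnit (1 - τ₁ • a₁)) {x : Fin 2 → A}
    (hx₀ : x 0 = (1 + z)⁻¹ • Ring.inverse (1 - τ₀ • a₀) - 1)
    (hx₁ : x 1 = (1 + z)⁻¹ • Ring.inverse (1 - τ₁ • a₁) - 1)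
    (hx : ‖(z / (1 + z))⁻¹ • (x 0 * x 1)‖ < 1) :
    Ring.inverse (1 - ((z / (1 + z))⁻¹ * (τ₀ * τ₁)) • (a₀ * a₁)) =
      (1 + z) • altResolvent x (z / (1 + z)) := by
  obtain ⟨u₀, hu₀⟩ := h₀
  obtain ⟨u₁, hu₁⟩ := h₁
  obtain ⟨r, hr⟩ : IsUnit (1 - (z / (1 + z))⁻¹ • (x 0 * x 1)) := (Units.oneSub _ hx).isUnit
  rw [← hu₀, Ring.inverse_unit] at hx₀
  rw [← hu₁, Ring.inverse_unit] at hx₁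
  have e₀ : (u₀ : A) * x 0 = (1 + z)⁻¹ • (1 : A) - u₀ := by
    rw [hx₀, mul_sub, mul_smul_comm, Units.mul_inv, mul_one]
  have e₁ : x 1 * (u₁ : A) = (1 + z)⁻¹ • (1 : A) - u₁ := by
    rw [hx₁, sub_mul, smul_mul_assoc, Units.inv_mul, one_mul]
  -- With p = z/(1+z) one has u₀x₀ = τ₀a₀ - p and x₁u₁ = τ₁a₁ - p. In u₀u₁ - p⁻¹(τ₀a₀ - p)(τ₁a₁ - p)
  -- the linear terms cancel, leaving (1 - p)(1 - p⁻¹τ₀τ₁a₀a₁), and 1 - p = (1+z)⁻¹.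
  have key : 1 - ((z / (1 + z))⁻¹ * (τ₀ * τ₁)) • (a₀ * a₁) = (1 + z) • ((u₀ * r * u₁ : Aˣ) : A) := by
    have e : (u₀ : A) * r * u₁ = u₀ * u₁ - (z / (1 + z))⁻¹ • ((u₀ * x 0) * (x 1 * u₁)) := by
      rw [hr, mul_sub, sub_mul, mul_one, mul_smul_comm, smul_mul_assoc]
      simp only [mul_assoc]
    rw [Units.val_mul, Units.val_mul, e, e₀, e₁, hu₀, hu₁]
    simp only [mul_sub, sub_mul, smul_mul_assoc, mul_smul_comm, mul_one, one_mul]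
    match_scalars <;> field_simp <;> ring
  have hres : altResolvent x (z / (1 + z)) =
      ((1 + z)⁻¹ * (1 + z)⁻¹) • (((u₀ * r * u₁)⁻¹ : Aˣ) : A) := by
    rw [altResolvent, ← hr, Ring.inverse_unit, hx₀, hx₁]
    simp [smul_smul, mul_assoc]
  -- The scalar multiple is exhibited as a unit so that `Ring.inverse` can be evaluated on it.
  have hs : (1 + z) • ((u₀ * r * u₁ : Aˣ) : A) =
      ((⟨(1 + z) • ((u₀ * r * u₁ : Aˣ) : A), (1 + z)⁻¹ • (((u₀ * r * u₁)⁻¹ : Aˣ) : A),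
        by rw [smul_mul_smul_comm, Units.mul_inv, mul_inv_cancel₀ hz1, one_smul],
        by rw [smul_mul_smul_comm, Units.inv_mul, inv_mul_cancel₀ hz1, one_smul]⟩ : Aˣ) : A) := rfl
  rw [key, hres, smul_smul, hs, Ring.inverse_unit, mul_inv_cancel_left₀ hz1]
  rfl

end Resolvents

end BiFree

namespace BiFree

/-! ### The inverse functions 𝒳 and the centred resolvents near 0. -/

section LocalInverse

variable {A : Type w} [NormedRing A] [NormedAlgebra ℂ A] [CompleteSpace A]
  {φ : A →L[ℂ] ℂ}

theorem psi_zero (hφ : φ 1 = 1) (a : A) : psi φ a 0 = 0 := by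
  simp [psi, hFun, hφ]

theorem chi_zero (hφ : φ 1 = 1) {a : A} (ha : φ a ≠ 0) : chi φ a 0 = 0 := by
  rw [chi, dif_pos ha]
  have h := ((hasStrictDerivAt_psi φ a).eventually_left_inverse ha).self_of_nhds
  rwa [psi_zero hφ] at h

theorem eventually_psi_chi (hφ : φ 1 = 1) {a : A} (ha : φ a ≠ 0) :
    ∀ᶠ z in 𝓝 0, psi φ a (chi φ a z) = z := by
  rw [chi, dif_pos ha]
  simpa only [psi_zero hφ] using (hasStrictDerivAt_psi φ a).eventually_right_inverse ha

theorem eventually_chi_psi {a : A} (ha : φ a ≠ 0) :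
    ∀ᶠ t in 𝓝 0, chi φ a (psi φ a t) = t := by
  rw [chi, dif_pos ha]
  exact (hasStrictDerivAt_psi φ a).eventually_left_inverse ha

theorem hasDerivAt_chi (hφ : φ 1 = 1) {a : A} (ha : φ a ≠ 0) :
    HasDerivAt (chi φ a) (φ a)⁻¹ 0 := by
  rw [chi, dif_pos ha]
  simpa only [psi_zero hφ] using ((hasStrictDerivAt_psi φ a).to_localInverse ha).hasDerivAt

theorem tendsto_chi (hφ : φ 1 = 1) {a : A} (ha : φ a ≠ 0) : Tendsto (chi φ a) (𝓝 0) (𝓝 0) := by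
  simpa [chi_zero hφ ha] using (hasDerivAt_chi hφ ha).continuousAt.tendsto

/-- The normalised and centred resolvent of `a` at the point `𝒳_a(z)`. -/
noncomputable def centred (φ : A →L[ℂ] ℂ) (a : A) (z : ℂ) : A :=
  (1 + z)⁻¹ • Ring.inverse (1 - chi φ a z • a) - 1

theorem centred_zero (hφ : φ 1 = 1) {a : A} (ha : φ a ≠ 0) : centred φ a 0 = 0 := by
  simp [centred, chi_zero hφ ha]

theorem differentiableAt_centred (hφ : φ 1 = 1) {a : A} (ha : φ a ≠ 0) :
    DifferentiableAt ℂ (centred φ a) 0 := by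
  have h1 : DifferentiableAt ℂ (fun z : ℂ => (1 : A) - chi φ a z • a) 0 :=
    (((hasDerivAt_chi hφ ha).differentiableAt).smul_const a).const_sub 1
  have h2 : DifferentiableAt ℂ (Ring.inverse : A → A) (1 - chi φ a 0 • a) := by
    rw [chi_zero hφ ha]
    simpa using (hasStrictFDerivAt_ringInverse (𝕜 := ℂ) (1 : Aˣ)).hasFDerivAt.differentiableAt
  have h3 : DifferentiableAt ℂ (fun z : ℂ => (1 + z)⁻¹) 0 :=
    (differentiableAt_id.const_add 1).inv (by simp)
  exact (h3.smul (h2.comp (0 : ℂ) h1)).sub_const 1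

theorem exists_norm_centred_le (hφ : φ 1 = 1) {a : A} (ha : φ a ≠ 0) :
    ∃ C, ∀ᶠ z in 𝓝 0, ‖centred φ a z‖ ≤ C * ‖z‖ := by
  obtain ⟨C, hC⟩ := (differentiableAt_centred hφ ha).isBigO_sub.bound
  exact ⟨C, by simpa [centred_zero hφ ha] using hC⟩

theorem eventually_norm_centred_lt (hφ : φ 1 = 1) {a : A} (ha : φ a ≠ 0) {ε : ℝ} (hε : 0 < ε) :
    ∀ᶠ z in 𝓝 0, ‖centred φ a z‖ < ε := by
  have h := (differentiableAt_centred hφ ha).continuousAt.norm.tendsto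
  rw [centred_zero hφ ha, norm_zero] at h
  exact h.eventually_lt_const hε

/-- Both factors are O(z), so their product is O(z²) and absorbs the division by z/(1+z) in the
series. -/
theorem eventually_norm_centred_mul_lt (hφ : φ 1 = 1) {a₀ a₁ : A} (h₀ : φ a₀ ≠ 0)
    (h₁ : φ a₁ ≠ 0) {ε : ℝ} (hε : 0 < ε) :
    ∀ᶠ z in 𝓝 0, z ≠ 0 → ‖centred φ a₀ z‖ * ‖centred φ a₁ z‖ < ε * ‖z / (1 + z)‖ := by
  obtain ⟨C₀, hC₀⟩ := exists_norm_centred_le hφ h₀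
  obtain ⟨C₁, hC₁⟩ := exists_norm_centred_le hφ h₁
  have hlim : Tendsto (fun z : ℂ => C₀ * C₁ * ‖z‖ * ‖1 + z‖) (𝓝 0) (𝓝 0) := by
    have : Continuous fun z : ℂ => C₀ * C₁ * ‖z‖ * ‖1 + z‖ := by fun_prop
    simpa using this.tendsto 0
  have hne : ∀ᶠ z : ℂ in 𝓝 0, 1 + z ≠ 0 :=
    (continuous_const.add continuous_id).continuousAt.eventually_ne (by simp)
  filter_upwards [hC₀, hC₁, hlim.eventually_lt_const hε, hne] with z h0 h1 h2 h3 hz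
  have hz' : 0 < ‖z‖ := norm_pos_iff.2 hz
  have h3' : 0 < ‖1 + z‖ := norm_pos_iff.2 h3
  rw [norm_div, mul_div_assoc', lt_div_iff₀ h3']
  calc ‖centred φ a₀ z‖ * ‖centred φ a₁ z‖ * ‖1 + z‖
      ≤ (C₀ * ‖z‖) * (C₁ * ‖z‖) * ‖1 + z‖ := by
        gcongr
        exact (norm_nonneg _).trans h0
    _ = (C₀ * C₁ * ‖z‖ * ‖1 + z‖) * ‖z‖ := by ring
    _ < ε * ‖z‖ := by gcongr

/-- The Neumann series writes the resolvent as a norm limit of polynomials in a. -/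
theorem centred_mem_closure {a : A} {z : ℂ} (h : ‖chi φ a z • a‖ < 1) :
    centred φ a z ∈ closure (Algebra.adjoin ℂ {a} : Set A) := by
  set S := (Algebra.adjoin ℂ {a}).topologicalClosure
  have ha : chi φ a z • a ∈ S := S.smul_mem
    ((Algebra.adjoin ℂ {a}).le_topologicalClosure (Algebra.self_mem_adjoin_singleton ℂ a)) _
  have hinv : Ring.inverse (1 - chi φ a z • a) ∈ S :=
    (Algebra.adjoin ℂ {a}).isClosed_topologicalClosure.mem_of_tendsto
      (hasSum_geom_series_inverse _ h).tendsto_sum_nat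
      (Eventually.of_forall fun n => sum_mem fun i _ => pow_mem ha i)
  exact S.sub_mem (S.smul_mem hinv _) S.one_mem

/-- The properties of the centred resolvents of `a₀`, `a₁` at a point `z` near `0`. -/
structure IsRegularPoint (φ : A →L[ℂ] ℂ) (a : Fin 2 → A) (ε : ℝ) (z : ℂ) : Prop where
  one_add_ne : 1 + z ≠ 0
  isUnit : ∀ k, IsUnit (1 - chi φ (a k) z • a k)
  mem_closure : ∀ k, centred φ (a k) z ∈ closure (Algebra.adjoin ℂ {a k} : Set A)
  apply_eq_zero : ∀ k, φ (centred φ (a k) z) = 0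
  norm_lt : ∀ k, ‖centred φ (a k) z‖ < ε
  norm_mul_lt : ‖centred φ (a 0) z‖ * ‖centred φ (a 1) z‖ < ε * ‖z / (1 + z)‖

theorem eventually_isRegularPoint (hφ : φ 1 = 1) {a : Fin 2 → A} (ha : ∀ k, φ (a k) ≠ 0) {ε : ℝ}
    (hε : 0 < ε) : ∀ᶠ z in 𝓝 0, z ≠ 0 → IsRegularPoint φ a ε z := by
  have hne : ∀ᶠ z : ℂ in 𝓝 0, 1 + z ≠ 0 :=
    (continuous_const.add continuous_id).continuousAt.eventually_ne (by simp)
  have hsmall : ∀ᶠ z in 𝓝 0, ∀ k, ‖chi φ (a k) z • a k‖ < 1 := eventually_all.2 fun k => by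
    have h := ((tendsto_chi hφ (ha k)).smul_const (a k)).norm
    rw [zero_smul, norm_zero] at h
    exact h.eventually_lt_const one_pos
  filter_upwards [hne, hsmall, eventually_all.2 fun k => eventually_psi_chi hφ (ha k),
    eventually_all.2 fun k => eventually_norm_centred_lt hφ (ha k) hε,
    eventually_norm_centred_mul_lt hφ (ha 0) (ha 1) hε] with z h1 h2 h3 h4 h5 hz
  refine ⟨h1, fun k => (Units.oneSub _ (h2 k)).isUnit, fun k => centred_mem_closure (h2 k),
    fun k => ?_, h4, h5 hz⟩
  have h := h3 k
  rw [psi, hFun, sub_eq_iff_eq_add'] at h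
  rw [centred, map_sub, map_smul, h, hφ, smul_eq_mul, inv_mul_cancel₀ h1, sub_self]

namespace IsRegularPoint

variable {a : Fin 2 → A} {ε : ℝ} {z : ℂ}

theorem norm_inv_smul_mul_lt (h : IsRegularPoint φ a ε z) (hz : z ≠ 0) :
    ‖(z / (1 + z))⁻¹ • (centred φ (a 0) z * centred φ (a 1) z)‖ < ε := by
  have hp : 0 < ‖z / (1 + z)‖ := norm_pos_iff.2 (div_ne_zero hz h.one_add_ne)
  rw [norm_smul, norm_inv, inv_mul_lt_iff₀ hp, mul_comm _ ε]
  exact (norm_mul_le _ _).trans_lt h.norm_mul_lt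

theorem inverse_one_sub_chi_smul (h : IsRegularPoint φ a ε z) (k : Fin 2) :
    Ring.inverse (1 - chi φ (a k) z • a k) = (1 + z) • (1 + centred φ (a k) z) := by
  rw [centred, add_sub_cancel, smul_smul, mul_inv_cancel₀ h.one_add_ne, one_smul]

theorem inverse_one_sub_smul_mul (h : IsRegularPoint φ a ε z) (hε : ε ≤ 1) (hz : z ≠ 0) :
    Ring.inverse (1 - ((z / (1 + z))⁻¹ * (chi φ (a 0) z * chi φ (a 1) z)) • (a 0 * a 1)) =
      (1 + z) • altResolvent (fun k => centred φ (a k) z) (z / (1 + z)) :=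
  BiFree.inverse_one_sub_smul_mul hz h.one_add_ne (h.isUnit 0) (h.isUnit 1) rfl rfl
    ((h.norm_inv_smul_mul_lt hz).trans_le hε)

end IsRegularPoint

/-- The centred elements of the closed algebras generated by `a 0` and `a 1` are free. -/
def IsFreePair (φ : A →L[ℂ] ℂ) (a : Fin 2 → A) : Prop :=
  ∀ x : Fin 2 → A, (∀ k, x k ∈ closure (Algebra.adjoin ℂ {a k} : Set A)) → (∀ k, φ (x k) = 0) →
    CentredFree φ x

theorem IsFreePair.apply_mul {a : Fin 2 → A} (h : IsFreePair φ a) (hφ : φ 1 = 1) :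
    φ (a 0 * a 1) = φ (a 0) * φ (a 1) := by
  -- Freeness is applied to the word 01 in the centred variables a_k - φ(a_k).
  have h1 := h (fun k => a k - algebraMap ℂ A (φ (a k)))
    (fun k => subset_closure (sub_mem (Algebra.self_mem_adjoin_singleton ℂ (a k))
      (Subalgebra.algebraMap_mem _ _)))
    (fun k => by simp [Algebra.algebraMap_eq_smul_one, hφ]) [0, 1] (by simp)
  simp [Algebra.algebraMap_eq_smul_one, hφ, mul_sub, sub_mul] at h1
  linear_combination h1

/-- The multiplicativity of `z ↦ (1 + z) / z * 𝒳_a(z)`. -/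
theorem IsFreePair.eventually_chi_mul {a : Fin 2 → A} (h : IsFreePair φ a) (hφ : φ 1 = 1)
    (ha : ∀ k, φ (a k) ≠ 0) : ∀ᶠ z in 𝓝 0, z ≠ 0 →
      chi φ (a 0 * a 1) z = (z / (1 + z))⁻¹ * (chi φ (a 0) z * chi φ (a 1) z) := by
  have ha' : φ (a 0 * a 1) ≠ 0 := by rw [h.apply_mul hφ]; exact mul_ne_zero (ha 0) (ha 1)
  -- The local inverse undoes ψ only near 0, so the candidate value must tend to 0. The quotient
  -- 𝒳_{a₁}(z)/z has a finite limit, and the factor 𝒳_{a₀}(z) tends to 0.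
  have hlim : Tendsto (fun z => (z / (1 + z))⁻¹ * (chi φ (a 0) z * chi φ (a 1) z))
      (𝓝[≠] 0) (𝓝 0) := by
    have h1 := (hasDerivAt_chi hφ (ha 1)).tendsto_slope
    have h0 : Tendsto (chi φ (a 0)) (𝓝[≠] 0) (𝓝 0) :=
      (tendsto_chi hφ (ha 0)).mono_left nhdsWithin_le_nhds
    have h2 : Tendsto (fun z : ℂ => 1 + z) (𝓝[≠] 0) (𝓝 (1 + 0)) :=
      ((continuous_const.add continuous_id).tendsto 0).mono_left nhdsWithin_le_nhds
    have h3 := (h2.mul h0).mul h1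
    rw [mul_zero, zero_mul] at h3
    refine h3.congr fun z => ?_
    rw [slope_def_field, chi_zero hφ (ha 1), sub_zero, sub_zero, inv_div]
    ring
  have hev := eventually_nhdsWithin_iff.1 (hlim.eventually (eventually_chi_psi ha'))
  filter_upwards [hev, eventually_isRegularPoint hφ ha one_pos] with z h1 h2 hz
  have hreg := h2 hz
  have hpsi : psi φ (a 0 * a 1) ((z / (1 + z))⁻¹ * (chi φ (a 0) z * chi φ (a 1) z)) = z := by
    rw [psi, hFun, hreg.inverse_one_sub_smul_mul le_rfl hz, map_smul,
      (h _ hreg.mem_closure hreg.apply_eq_zero).apply_altResolvent (hreg.norm_inv_smul_mul_lt hz)]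
    simp
  have h4 := h1 hz
  rwa [hpsi] at h4

end LocalInverse

/-! ### Bi-free pairs and multiplicativity of the partial S-transform. -/

section BiFreePairs

variable {A : Type w} [NormedRing A] [NormedAlgebra ℂ A] [CompleteSpace A]
  {φ : A →L[ℂ] ℂ} {a b : Fin 2 → A}

/-- This is the case of an empty right word; the right elements play no role and are set to 0. -/
theorem IsBiFree.isFreePair_left (h : IsBiFree.{0, v, w} (φ : A →ₗ[ℂ] ℂ) a b) (hφ : φ 1 = 1) :
    IsFreePair φ a := fun x hx hx0 l hl => by
  have h1 := h.apply_prod_mul_prod_of_mem_closure hφ hx (y := 0)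
    (fun k => subset_closure (zero_mem _)) hx0 (by simp) l [] hl List.isChain_nil
  rw [List.map_nil, List.prod_nil, mul_one] at h1
  rw [h1]
  split_ifs with hl' <;> simp [hl']

theorem IsBiFree.isFreePair_right (h : IsBiFree.{0, v, w} (φ : A →ₗ[ℂ] ℂ) a b) (hφ : φ 1 = 1) :
    IsFreePair φ b := fun y hy hy0 l hl => by
  have h1 := h.apply_prod_mul_prod_of_mem_closure hφ (x := 0) (y := y)
    (fun k => subset_closure (zero_mem _)) hy (by simp) hy0 [] l List.isChain_nil hl
  rw [List.map_nil, List.prod_nil, one_mul] at h1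
  rw [h1]
  simp [eq_comm]

/-- The resolvents are (1+z)(1+x_k) and (1+w)(1+y_k), and centring kills the cross terms φ(x_k),
φ(y_k). -/
theorem IsRegularPoint.HFun_chi {ε : ℝ} {z w : ℂ} (hz : IsRegularPoint φ a ε z)
    (hw : IsRegularPoint φ b ε w) (hφ : φ 1 = 1) (k : Fin 2) :
    HFun φ (a k) (b k) (chi φ (a k) z) (chi φ (b k) w) =
      (1 + z) * (1 + w) * (1 + φ (centred φ (a k) z * centred φ (b k) w)) := by
  rw [HFun, hz.inverse_one_sub_chi_smul, hw.inverse_one_sub_chi_smul, smul_mul_smul_comm, map_smul]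
  simp [mul_add, add_mul, hφ, hz.apply_eq_zero, hw.apply_eq_zero]

/-- The algebraic identity behind the multiplicativity of the partial S-transform. -/
theorem partialS_identity {z w G₀ G₁ : ℂ} (hz : z ≠ 0) (hw : w ≠ 0) (hz1 : 1 + z ≠ 0)
    (hw1 : 1 + w ≠ 0) (h₀ : 1 + G₀ ≠ 0) (h₁ : 1 + G₁ ≠ 0)
    (hD : 1 - (z / (1 + z))⁻¹ * (w / (1 + w))⁻¹ * (G₀ * G₁) ≠ 0) :
    (z + 1) / z * ((w + 1) / w) * (1 - (1 + z + w) / ((1 + z) * (1 + w) *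
        ((1 + G₀) * (1 + G₁) / (1 - (z / (1 + z))⁻¹ * (w / (1 + w))⁻¹ * (G₀ * G₁))))) =
      (z + 1) / z * ((w + 1) / w) * (1 - (1 + z + w) / ((1 + z) * (1 + w) * (1 + G₀))) *
        ((z + 1) / z * ((w + 1) / w) * (1 - (1 + z + w) / ((1 + z) * (1 + w) * (1 + G₁)))) := by
  have e : (1 + z + w) / ((1 + z) * (1 + w) *
      ((1 + G₀) * (1 + G₁) / (1 - (z / (1 + z))⁻¹ * (w / (1 + w))⁻¹ * (G₀ * G₁)))) =
      (1 + z + w) * (1 - (z / (1 + z))⁻¹ * (w / (1 + w))⁻¹ * (G₀ * G₁)) /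
        ((1 + z) * (1 + w) * ((1 + G₀) * (1 + G₁))) := by
    generalize 1 - (z / (1 + z))⁻¹ * (w / (1 + w))⁻¹ * (G₀ * G₁) = d at hD ⊢
    field_simp
  rw [e]
  field_simp
  ring

theorem norm_apply_mul_lt {ε : ℝ} (hε : ε ≤ 1) (hφε : ‖φ‖ * ε < 1) {x y : A} (hx : ‖x‖ < ε)
    (hy : ‖y‖ < ε) : ‖φ (x * y)‖ < 1 := by
  have hε0 : 0 ≤ ε := (norm_nonneg x).trans hx.le
  calc ‖φ (x * y)‖ ≤ ‖φ‖ * (‖x‖ * ‖y‖) :=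
        (φ.le_opNorm _).trans (by gcongr; exact norm_mul_le _ _)
    _ ≤ ‖φ‖ * (ε * 1) := by gcongr; exact hy.le.trans hε
    _ < 1 := by rwa [mul_one]

theorem one_add_ne_zero_of_norm_lt {c : ℂ} (h : ‖c‖ < 1) : 1 + c ≠ 0 := fun h0 => by
  rw [eq_neg_of_add_eq_zero_right h0] at h
  simp at h

theorem one_sub_ne_zero_of_norm_lt {c : ℂ} (h : ‖c‖ < 1) : 1 - c ≠ 0 := by
  rw [sub_eq_add_neg]
  exact one_add_ne_zero_of_norm_lt (by rwa [norm_neg])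

/-- Convergence of the diagonal geometric series. Regrouping the four norms as (‖x₀‖‖x₁‖)(‖y₀‖‖y₁‖)
produces the factors z/(1+z) and w/(1+w) that cancel the denominators, independently of the relative
sizes of z and w. -/
theorem IsRegularPoint.norm_moments_lt {ε : ℝ} (hε : 0 < ε) (hφε : ‖φ‖ * ε < 1) {z w : ℂ}
    (hzr : IsRegularPoint φ a ε z) (hwr : IsRegularPoint φ b ε w) (hz : z ≠ 0) (hw : w ≠ 0) :
    ‖(z / (1 + z))⁻¹ * (w / (1 + w))⁻¹ * (φ (centred φ (a 0) z * centred φ (b 0) w) *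
      φ (centred φ (a 1) z * centred φ (b 1) w))‖ < 1 := by
  have hp : 0 < ‖z / (1 + z)‖ := norm_pos_iff.2 (div_ne_zero hz hzr.one_add_ne)
  have hq : 0 < ‖w / (1 + w)‖ := norm_pos_iff.2 (div_ne_zero hw hwr.one_add_ne)
  have hle : ∀ x y : A, ‖φ (x * y)‖ ≤ ‖φ‖ * (‖x‖ * ‖y‖) := fun x y =>
    (φ.le_opNorm _).trans (by gcongr; exact norm_mul_le _ _)
  rw [← mul_inv, norm_mul, norm_inv, norm_mul, inv_mul_lt_iff₀ (mul_pos hp hq), mul_one, norm_mul]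
  calc _ ≤ (‖φ‖ * (‖centred φ (a 0) z‖ * ‖centred φ (b 0) w‖)) *
        (‖φ‖ * (‖centred φ (a 1) z‖ * ‖centred φ (b 1) w‖)) := by gcongr <;> exact hle _ _
    _ = ‖φ‖ ^ 2 * ((‖centred φ (a 0) z‖ * ‖centred φ (a 1) z‖) *
        (‖centred φ (b 0) w‖ * ‖centred φ (b 1) w‖)) := by ring
    _ ≤ ‖φ‖ ^ 2 * ((ε * ‖z / (1 + z)‖) * (ε * ‖w / (1 + w)‖)) := by
        exact mul_le_mul_of_nonneg_left (mul_le_mul hzr.norm_mul_lt.le hwr.norm_mul_lt.le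
          (by positivity) (by positivity)) (by positivity)
    _ = (‖φ‖ * ε) ^ 2 * (‖z / (1 + z)‖ * ‖w / (1 + w)‖) := by ring
    _ < 1 * (‖z / (1 + z)‖ * ‖w / (1 + w)‖) := by
        gcongr
        exact pow_lt_one₀ (by positivity) hφε two_ne_zero
    _ = _ := one_mul _

theorem IsBiFree.eventually_partialS_mul (h : IsBiFree.{0, v, w} (φ : A →ₗ[ℂ] ℂ) a b)
    (hφ : φ 1 = 1) (ha : ∀ k, φ (a k) ≠ 0) (hb : ∀ k, φ (b k) ≠ 0) :
    ∀ᶠ p : ℂ × ℂ in 𝓝 (0, 0), p.1 ≠ 0 → p.2 ≠ 0 →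
      partialS φ (a 0 * a 1) (b 0 * b 1) p.1 p.2 =
        partialS φ (a 0) (b 0) p.1 p.2 * partialS φ (a 1) (b 1) p.1 p.2 := by
  -- Chosen so that both ε ≤ 1 and ‖φ‖ε < 1, which makes all the series converge and keeps each 1 +
  -- φ(x_k y_k) away from zero.
  set ε : ℝ := (1 + ‖φ‖)⁻¹
  have hpos : 0 < 1 + ‖φ‖ := by positivity
  have hε : 0 < ε := inv_pos.2 hpos
  have hε1 : ε ≤ 1 := inv_le_one_of_one_le₀ (by simp)
  have hφε : ‖φ‖ * ε < 1 := by rw [← div_eq_mul_inv, div_lt_one hpos]; linarith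
  have hA := (eventually_isRegularPoint hφ ha hε).and
    ((h.isFreePair_left hφ).eventually_chi_mul hφ ha)
  have hB := (eventually_isRegularPoint hφ hb hε).and
    ((h.isFreePair_right hφ).eventually_chi_mul hφ hb)
  filter_upwards [hA.prod_nhds hB] with ⟨z, w⟩ ⟨⟨hzr, hz'⟩, ⟨hwr, hw'⟩⟩ hz hw
  dsimp only at hzr hz' hwr hw' hz hw ⊢
  replace hzr := hzr hz
  replace hwr := hwr hw
  have hc : CentredBiFree φ (fun k => centred φ (a k) z) (fun k => centred φ (b k) w) :=
    h.apply_prod_mul_prod_of_mem_closure hφ hzr.mem_closure hwr.mem_closure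
      hzr.apply_eq_zero hwr.apply_eq_zero
  have hD := hzr.norm_moments_lt hε hφε hwr hz hw
  have hG : ∀ k, 1 + φ (centred φ (a k) z * centred φ (b k) w) ≠ 0 := fun k =>
    one_add_ne_zero_of_norm_lt (norm_apply_mul_lt hε1 hφε (hzr.norm_lt k) (hwr.norm_lt k))
  rw [partialS, partialS, partialS, hzr.HFun_chi hwr hφ, hzr.HFun_chi hwr hφ, HFun, hz' hz, hw' hw,
    hzr.inverse_one_sub_smul_mul hε1 hz, hwr.inverse_one_sub_smul_mul hε1 hw, smul_mul_smul_comm,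
    map_smul, hc.apply_altResolvent_mul_altResolvent ((hzr.norm_inv_smul_mul_lt hz).trans_le hε1)
      ((hwr.norm_inv_smul_mul_lt hw).trans_le hε1) hD, smul_eq_mul]
  exact partialS_identity hz hw hzr.one_add_ne hwr.one_add_ne (hG 0) (hG 1)
    (one_sub_ne_zero_of_norm_lt hD)

end BiFreePairs

end BiFree

theorem theorem2p1 {A : Type w} [NormedRing A] [NormedAlgebra ℂ A] [CompleteSpace A]
    (φ : A →L[ℂ] ℂ) (hφ : φ 1 = 1) (a₁ a₂ b₁ b₂ : A)
    (hfree : BiFree.IsBiFree.{0, v, w} (φ : A →ₗ[ℂ] ℂ) ![a₁, a₂] ![b₁, b₂])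
    (ha₁ : φ a₁ ≠ 0) (ha₂ : φ a₂ ≠ 0) (hb₁ : φ b₁ ≠ 0) (hb₂ : φ b₂ ≠ 0) :
    φ (a₁ * a₂) ≠ 0 ∧ φ (b₁ * b₂) ≠ 0 ∧
      ∀ᶠ p : ℂ × ℂ in nhds (0, 0), p.1 ≠ 0 → p.2 ≠ 0 →
        BiFree.partialS φ (a₁ * a₂) (b₁ * b₂) p.1 p.2 =
          BiFree.partialS φ a₁ b₁ p.1 p.2 * BiFree.partialS φ a₂ b₂ p.1 p.2 := by
  have ha : ∀ k, φ ((![a₁, a₂] : Fin 2 → A) k) ≠ 0 := by simp [Fin.forall_fin_two, ha₁, ha₂]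
  have hb : ∀ k, φ ((![b₁, b₂] : Fin 2 → A) k) ≠ 0 := by simp [Fin.forall_fin_two, hb₁, hb₂]
  have h₁ := (hfree.isFreePair_left hφ).apply_mul hφ
  have h₂ := (hfree.isFreePair_right hφ).apply_mul hφ
  simp only [Matrix.cons_val_zero, Matrix.cons_val_one] at h₁ h₂
  exact ⟨h₁ ▸ mul_ne_zero ha₁ ha₂, h₂ ▸ mul_ne_zero hb₁ hb₂,
    hfree.eventually_partialS_mul hφ ha hb⟩
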